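/- Points of $\mathbb R^2$ are written $(q,p)$. An \emph{integrator} is a map $\Phi$ that takes a Hamiltonian $H:\mathbb R^2\to\mathbb R$, a state $z\in\mathbb R^2$ and a step $\Delta t\in[0,\infty)$, and either returns a point $\Phi(H,z,\Delta t)\in\mathbb R^2$ or is undefined. Suppose the following. 1. Consistency at $(0,1)$: for $H_0(q,p)=p^2/2$, with Hamiltonian flow $S^t$, the value $\Phi(H_0,(0,1),\Delta t)$ is defined for all small $\Delta t>0$ and $\lim_{\Delta t\to0^+}\|S^{\Delta t}(0,1)-\Phi(H_0,(0,1),\Delta t)\|/\Delta t=0$. 2. $\Phi$ is computationally reasonable: for every smooth $H$, every $z\in\mathbb R^2$ and every $\Delta t\ge0$ there are $m\in\mathbb N_0$, points $r^1,\dots,r^m\in\mathbb R^2$ and multi-indices $\alpha^1,\dots,\alpha^m\in\mathbb N_0^2$ such that for every smooth $\widetilde H$ with $\partial_{\alpha^j}\widetilde H(r^j)=\partial_{\alpha^j}H(r^j)$ for $j=1,\dots,m$, either $\Phi(\widetilde H,z,\Delta t)=\Phi(H,z,\Delta t)$ or both are undefined. 3. $\Phi$ conserves energy: $H(\Phi(H,z,\Delta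 t))=H(z)$ for every smooth $H$, every $z$ and every $\Delta t\ge0$ for which $\Phi(H,z,\Delta t)$ is defined. 4. There are an open set $U\subseteq\mathbb R^2$ containing the line $\{(q,1):q\in\mathbb R\}$ and a $\Delta t_0>0$ such that for $0<\Delta t\le\Delta t_0$ the map $\Phi(H_0,\cdot,\Delta t)$ is defined, continuous and area-conserving on $U$. Here a map $\varphi$ is \emph{area-conserving} on $U$ if every point of $U$ has a neighbourhood $W$ such that $\varphi(A)$ and $A$ have the same Lebesgue measure for every measurable $A\subseteq W\cap U$ (for a $C^1$ map: its Jacobian determinant is $\pm1$ at every point of $U$). Then there is $\Delta t_1>0$ such that for every $\Delta t\in(0,\Delta t_1]$ there is a compactly supported $C^\infty$ function $V:\mathbb R\to\mathbb R$ with $0\le V<1/2$ such that, for $\widetilde H(q,p)=p^2/2+V(q)$, the map $\Phi(\widetilde H,\cdot,\Delta t)$ is not simultaneously defined, continuous and area-conserving on $U$; and, for this same $V$, the same holds with $V$ replaced by $\lambda V$ for every $\lambda\in(0,1)$. -/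

import Mathlib

open Set Filter Topology MeasureTheory
open scoped NNReal ContDiff

noncomputable section

namespace OneDOF

/-- An integrator for one-degree-of-freedom systems: it takes a Hamiltonian `H`, a state
`(q, p)` and a step length in `[0, ∞)`, and either returns a new state or is undefined (`none`). -/
abbrev Integrator : Type :=
  (ℝ × ℝ → ℝ) → ℝ × ℝ → ℝ≥0 → Option (ℝ × ℝ)

/-- The mixed partial derivative `∂_q^a ∂_p^b H` at `z = (q, p)`, for `α = (a, b)`. -/
def partialD (α : ℕ × ℕ) (H : ℝ × ℝ → ℝ) (z : ℝ × ℝ) : ℝ :=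
  iteratedDeriv α.1 (fun q => iteratedDeriv α.2 (fun p => H (q, p)) z.2) z.1

/-- The Hamiltonian vector field `(∂H/∂p, -∂H/∂q)`. -/
def hamVF (H : ℝ × ℝ → ℝ) (z : ℝ × ℝ) : ℝ × ℝ :=
  (partialD (0, 1) H z, -partialD (1, 0) H z)

/-- The step from `z` depends on the smooth Hamiltonian `H` only through finitely many of the
values of `H` and its partial derivatives. -/
def ComputationallyReasonable (Φ : Integrator) : Prop :=
  ∀ H : ℝ × ℝ → ℝ, ContDiff ℝ ∞ H → ∀ (z : ℝ × ℝ) (Δt : ℝ≥0),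
    ∃ (m : ℕ) (r : Fin m → ℝ × ℝ) (α : Fin m → ℕ × ℕ),
      ∀ H' : ℝ × ℝ → ℝ, ContDiff ℝ ∞ H' →
        (∀ j, partialD (α j) H' (r j) = partialD (α j) H (r j)) →
          Φ H z Δt = Φ H' z Δt

/-- Energy is conserved wherever the integrator is defined. -/
def EnergyConserving (Φ : Integrator) : Prop :=
  ∀ H : ℝ × ℝ → ℝ, ContDiff ℝ ∞ H → ∀ (z : ℝ × ℝ) (Δt : ℝ≥0) (w : ℝ × ℝ),
    Φ H z Δt = some w → H w = H z

/-- Consistency at `z` for the Hamiltonian `H`: the step is defined for all small `Δt > 0`, and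
`‖S^Δt z - Φ(H, z, Δt)‖ / Δt → 0` as `Δt → 0⁺`, where `γ t = S^t z` solves Hamilton's equations
for `t` near `0` with `γ 0 = z`. -/
def ConsistentAt (Φ : Integrator) (H : ℝ × ℝ → ℝ) (z : ℝ × ℝ) : Prop :=
  ∃ (γ : ℝ → ℝ × ℝ) (φ : ℝ≥0 → ℝ × ℝ),
    γ 0 = z ∧ IsIntegralCurveAt γ (fun _ => hamVF H) 0 ∧
    (∀ᶠ Δt in 𝓝[>] (0 : ℝ≥0), Φ H z Δt = some (φ Δt)) ∧
    Tendsto (fun Δt : ℝ≥0 => ‖γ (Δt : ℝ) - φ Δt‖ / (Δt : ℝ)) (𝓝[>] 0) (𝓝 0)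

/-- `φ` conserves area on `U`: around each point of `U`, it preserves the Lebesgue measure of all
measurable sets. (For an injective continuous map this is preservation of the area of every
measurable subset of `U`; for a `C¹` map it says that the Jacobian determinant is `±1`.) -/
def AreaConservingOn (φ : ℝ × ℝ → ℝ × ℝ) (U : Set (ℝ × ℝ)) : Prop :=
  ∀ z ∈ U, ∃ W ∈ 𝓝 z, ∀ A : Set (ℝ × ℝ), A ⊆ W ∩ U → MeasurableSet A →
    volume (φ '' A) = volume A

/-- The partial map `F` is defined, continuous and area-conserving on `U`. -/
def DefinedContAreaOn (F : ℝ × ℝ → Option (ℝ × ℝ)) (U : Set (ℝ × ℝ)) : Prop :=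
  ∃ φ : ℝ × ℝ → ℝ × ℝ, (∀ z ∈ U, F z = some (φ z)) ∧ ContinuousOn φ U ∧ AreaConservingOn φ U

/-- The Hamiltonian `p²/2 + V(q)`. -/
def mechH (V : ℝ → ℝ) (z : ℝ × ℝ) : ℝ := z.2 ^ 2 / 2 + V z.1

/-- The Hamiltonian `p²/2`. -/
def freeH (z : ℝ × ℝ) : ℝ := z.2 ^ 2 / 2

end OneDOF

end

namespace OneDOF

/-! Between the energy levels of `p = 1` and `p = 1 + s`, the shell of `p²/2 + W(q)` over an
interval has area about `s` times the travel time ∫ dq/√(1 - 2W). Conserving energy and area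
therefore forbids increasing travel times (`abs_integral_slowness_le`); only a covering inequality
is needed, so injectivity plays no role.

For the free Hamiltonian, travel time is distance, and the images of (0,1) and (η,1) are exactly η
apart (`exists_abs_sub_eq`). By consistency (0,1) moves right, so for small η part of the gap
between the images lies beyond [0,η]. A bump placed there, away from the finitely many positions
sampled in the steps from (0,1) and (η,1), leaves both images unchanged. It slows the motion between
them, so their travel time exceeds η: a contradiction. -/

/-! ### Travel times and thin energy shells -/

/-- The inverse speed `1 / √(1 - 2 W)` along the energy level `1/2` of `p²/2 + W(q)`. -/
noncomputable def slowness (W : ℝ → ℝ) (q : ℝ) : ℝ := (√(1 - 2 * W q))⁻¹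

theorem sqrt_speed_pos {W : ℝ → ℝ} (hW : ∀ q, W q < 1 / 2) (q : ℝ) : 0 < √(1 - 2 * W q) :=
  Real.sqrt_pos.2 (by linarith [hW q])

theorem continuous_slowness {W : ℝ → ℝ} (hWc : Continuous W) (hW : ∀ q, W q < 1 / 2) :
    Continuous (slowness W) :=
  Continuous.inv₀ (by fun_prop) fun q => (sqrt_speed_pos hW q).ne'

/-- Shell thickness with the factor `s` pulled out; the cofactor stays continuous at `s = 0`, where
it equals the slowness. -/
theorem sqrt_sub_sqrt_eq {k s : ℝ} (hk : k < 1 / 2) (hs : 0 < s) :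
    √((1 + s) ^ 2 - 2 * k) - √(1 - 2 * k) =
      s * ((2 + s) / (√((1 + s) ^ 2 - 2 * k) + √(1 - 2 * k))) := by
  have h1 : 0 < √(1 - 2 * k) := Real.sqrt_pos.2 (by linarith)
  have h2 : 0 ≤ √((1 + s) ^ 2 - 2 * k) := Real.sqrt_nonneg _
  have e1 : √(1 - 2 * k) ^ 2 = 1 - 2 * k := Real.sq_sqrt (by linarith)
  have e2 : √((1 + s) ^ 2 - 2 * k) ^ 2 = (1 + s) ^ 2 - 2 * k := Real.sq_sqrt (by nlinarith)
  field_simp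
  nlinarith

/-- If the image of every thin rectangle `[a, b] × (1, 1 + s)` covers the part of the energy shell
over `[u, v]`, the travel time from `u` to `v` is at most `b - a`. -/
theorem integral_slowness_le_of_cover {W : ℝ → ℝ} (hWc : Continuous W) (hW : ∀ q, W q < 1 / 2)
    {φ : ℝ × ℝ → ℝ × ℝ} {a b u v s₀ : ℝ} (hab : a ≤ b) (huv : u ≤ v) (hs₀ : 0 < s₀)
    (hvol : ∀ s ∈ Ioo 0 s₀, volume (φ '' (Icc a b ×ˢ Ioo 1 (1 + s))) =
      volume (Icc a b ×ˢ Ioo (1 : ℝ) (1 + s)))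
    (hcov : ∀ s ∈ Ioo 0 s₀,
      regionBetween (fun q => √(1 - 2 * W q)) (fun q => √((1 + s) ^ 2 - 2 * W q)) (Ioc u v) ⊆
        φ '' (Icc a b ×ˢ Ioo 1 (1 + s))) :
    ∫ q in u..v, slowness W q ≤ b - a := by
  set K : ℝ → ℝ → ℝ := fun s q => (2 + s) / (√((1 + s) ^ 2 - 2 * W q) + √(1 - 2 * W q)) with hK
  have hKc : Continuous (Function.uncurry K) := by
    refine Continuous.div (by fun_prop) (by fun_prop) fun z => ?_
    have := sqrt_speed_pos hW z.2
    have := Real.sqrt_nonneg ((1 + z.1) ^ 2 - 2 * W z.2)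
    positivity
  have hle : ∀ s ∈ Ioo 0 s₀, ∫ q in u..v, K s q ≤ b - a := by
    intro s hs
    have h := measure_mono (μ := volume) (hcov s hs)
    rw [hvol s hs, Measure.volume_eq_prod, Measure.prod_prod, Real.volume_Icc, Real.volume_Ioo,
      ← ENNReal.ofReal_mul (by linarith),
      volume_regionBetween_eq_integral
        ((by fun_prop : Continuous fun q => √(1 - 2 * W q)).integrableOn_Ioc)
        ((by fun_prop : Continuous fun q => √((1 + s) ^ 2 - 2 * W q)).integrableOn_Ioc)
        measurableSet_Ioc
        (fun q _ => Real.sqrt_le_sqrt (by nlinarith [hs.1])),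
      ENNReal.ofReal_le_ofReal_iff (mul_nonneg (by linarith) (by linarith [hs.1])),
      ← intervalIntegral.integral_of_le huv] at h
    have e : ∀ q, ((fun q => √((1 + s) ^ 2 - 2 * W q)) - fun q => √(1 - 2 * W q)) q
        = s * K s q := fun q => sqrt_sub_sqrt_eq (hW q) hs.1
    simp only [e] at h
    rw [intervalIntegral.integral_const_mul] at h
    have := hs.1
    nlinarith
  have hcont : Continuous fun s => ∫ q in u..v, K s q :=
    intervalIntegral.continuous_parametric_intervalIntegral_of_continuous' hKc u v
  have h0 : ∫ q in u..v, K 0 q ≤ b - a := by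
    refine le_of_tendsto (hcont.continuousAt.tendsto.mono_left (nhdsWithin_le_nhds (s := Ioi 0))) ?_
    filter_upwards [Ioo_mem_nhdsGT hs₀] with s hs using hle s hs
  have e : slowness W = K 0 := by
    funext q
    have := sqrt_speed_pos hW q
    simp only [slowness, hK]
    norm_num
    field_simp
    norm_num
  rw [e]; exact h0

/-- A continuous map that preserves `p²/2 + W(q)` sends a rectangle onto the part of the energy
shell lying over any interval between the positions of the images of its vertical sides. -/
theorem regionBetween_subset_image {W : ℝ → ℝ} (hW : ∀ q, W q < 1 / 2)
    {φ : ℝ × ℝ → ℝ × ℝ} {a b u v s : ℝ} (hab : a ≤ b) (hs : 0 < s)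
    (hWab : ∀ q ∈ Icc a b, W q = 0)
    (hφ : ContinuousOn φ (Icc a b ×ˢ Ioo 1 (1 + s)))
    (hpos : ∀ z ∈ Icc a b ×ˢ Ioo 1 (1 + s), 0 < (φ z).2)
    (hen : ∀ z ∈ Icc a b ×ˢ Ioo 1 (1 + s), mechH W (φ z) = mechH W z)
    (hcov : ∀ p ∈ Ioo 1 (1 + s), Icc u v ⊆ uIcc (φ (a, p)).1 (φ (b, p)).1) :
    regionBetween (fun q => √(1 - 2 * W q)) (fun q => √((1 + s) ^ 2 - 2 * W q)) (Ioc u v) ⊆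
      φ '' (Icc a b ×ˢ Ioo 1 (1 + s)) := by
  rintro ⟨q, y⟩ ⟨hq, hy1, hy2⟩
  simp only at hq hy1 hy2
  have hWq := hW q
  have hy0 : 0 < y := (sqrt_speed_pos hW q).trans hy1
  have h1 : 1 - 2 * W q < y ^ 2 := (Real.sqrt_lt' hy0).1 hy1
  have h2 : y ^ 2 < (1 + s) ^ 2 - 2 * W q := (Real.lt_sqrt hy0.le).1 hy2
  -- The only height in the rectangle with the energy of `(q, y)`, since `W` vanishes over `[a, b]`.
  set p := √(y ^ 2 + 2 * W q) with hp
  have hp2 : p ^ 2 = y ^ 2 + 2 * W q := Real.sq_sqrt (by linarith)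
  have hpI : p ∈ Ioo 1 (1 + s) :=
    ⟨Real.lt_sqrt zero_le_one |>.2 (by linarith), (Real.sqrt_lt' (by linarith)).2 (by linarith)⟩
  have hc : ContinuousOn (fun t => (φ (t, p)).1) (uIcc a b) := by
    rw [uIcc_of_le hab]
    refine continuous_fst.comp_continuousOn (hφ.comp (by fun_prop) fun t ht => ⟨ht, hpI⟩)
  obtain ⟨t, ht, htq⟩ := intermediate_value_uIcc hc (hcov p hpI (Ioc_subset_Icc_self hq))
  rw [uIcc_of_le hab] at ht
  have hm : (t, p) ∈ Icc a b ×ˢ Ioo 1 (1 + s) := ⟨ht, hpI⟩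
  refine ⟨(t, p), hm, Prod.ext htq ?_⟩
  have h3 := hen _ hm
  have h4 := hpos _ hm
  simp only at htq
  simp only [mechH, htq, hWab t ht] at h3
  show (φ (t, p)).2 = y
  nlinarith

/-- Near a point of the line `p = 1` where `W` vanishes, an energy- and area-conserving map does not
increase travel times. -/
theorem exists_integral_slowness_le {W : ℝ → ℝ} (hWc : Continuous W) (hW : ∀ q, W q < 1 / 2)
    {φ : ℝ × ℝ → ℝ × ℝ} {U : Set (ℝ × ℝ)} (hUo : IsOpen U) (hφ : ContinuousOn φ U)
    (harea : AreaConservingOn φ U) (hen : ∀ z ∈ U, mechH W (φ z) = mechH W z)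
    {x : ℝ} (hxU : (x, (1 : ℝ)) ∈ U) (hpos : 0 < (φ (x, 1)).2) :
    ∃ δ > 0, ∀ a b, x - δ < a → a ≤ b → b < x + δ → (∀ q ∈ Icc a b, W q = 0) →
      |∫ q in (φ (a, 1)).1..(φ (b, 1)).1, slowness W q| ≤ b - a := by
  obtain ⟨N, hN, hNarea⟩ := harea _ hxU
  have hcx : ContinuousAt φ (x, 1) := hφ.continuousAt (hUo.mem_nhds hxU)
  have hpn : ∀ᶠ z in 𝓝 (x, (1 : ℝ)), 0 < (φ z).2 :=
    (continuous_snd.continuousAt.comp hcx).eventually (lt_mem_nhds hpos)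
  obtain ⟨δ, hδ, hball⟩ := Metric.mem_nhds_iff.1 (inter_mem (inter_mem hN (hUo.mem_nhds hxU)) hpn)
  have hbox : ∀ q p, x - δ < q → q < x + δ → 1 - δ < p → p < 1 + δ →
      (q, p) ∈ (N ∩ U) ∩ {z | 0 < (φ z).2} := by
    intro q p h1 h2 h3 h4
    refine hball ?_
    rw [Metric.mem_ball, Prod.dist_eq, max_lt_iff, Real.dist_eq, Real.dist_eq, abs_lt, abs_lt]
    refine ⟨⟨?_, ?_⟩, ?_, ?_⟩ <;> simp only <;> linarith
  refine ⟨δ, hδ, fun a b ha hab hb hWab => ?_⟩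
  have hat : ∀ q ∈ Icc a b, ContinuousAt (fun p : ℝ => (φ (q, p)).1) 1 := by
    intro q hq
    have h := (hbox q 1 (by linarith [hq.1]) (by linarith [hq.2]) (by linarith) (by linarith)).1.2
    have h2 : ContinuousAt φ (q, 1) := hφ.continuousAt (hUo.mem_nhds h)
    exact continuous_fst.continuousAt.comp
      (ContinuousAt.comp (f := fun p : ℝ => (q, p)) h2 (by fun_prop))
  -- Covering is required for `p` near 1, not just at 1; it will hold for `u`, `v` strictly between
  -- the image positions, and `lim` then passes to the endpoints.
  have key : ∀ u v, u ≤ v →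
      (∀ᶠ p in 𝓝 (1 : ℝ), Icc u v ⊆ uIcc (φ (a, p)).1 (φ (b, p)).1) →
      ∫ q in u..v, slowness W q ≤ b - a := by
    intro u v huv hev
    obtain ⟨ε, hε, hεb⟩ := Metric.eventually_nhds_iff.1 hev
    have hmem : ∀ s ∈ Ioo 0 (min ε δ), ∀ z ∈ Icc a b ×ˢ Ioo 1 (1 + s),
        z ∈ (N ∩ U) ∩ {z | 0 < (φ z).2} := by
      rintro s hs ⟨q, p⟩ ⟨hq, hp⟩
      have := lt_min_iff.1 hs.2
      exact hbox q p (by linarith [hq.1]) (by linarith [hq.2]) (by linarith [hp.1])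
        (by linarith [hp.2])
    refine integral_slowness_le_of_cover hWc hW hab huv (lt_min hε hδ) (φ := φ) ?_ ?_
    · intro s hs
      exact hNarea _ (fun z hz => (hmem s hs z hz).1) (measurableSet_Icc.prod measurableSet_Ioo)
    · intro s hs
      refine regionBetween_subset_image hW hab hs.1 hWab (hφ.mono fun z hz => (hmem s hs z hz).1.2)
        (fun z hz => (hmem s hs z hz).2) (fun z hz => hen z (hmem s hs z hz).1.2) ?_
      intro p hp
      have := lt_min_iff.1 hs.2
      refine hεb ?_
      rw [Real.dist_eq, abs_lt]
      constructor <;> linarith [hp.1, hp.2]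
  have hsc := continuous_slowness hWc hW
  have lim : ∀ g h : ℝ, g < h →
      (∀ u v, g < u → u ≤ v → v < h → ∫ q in u..v, slowness W q ≤ b - a) →
      ∫ q in g..h, slowness W q ≤ b - a := by
    intro g h hgh H
    have hint : ∀ y z, IntervalIntegrable (slowness W) volume y z :=
      fun y z => hsc.intervalIntegrable y z
    set T : ℝ → ℝ := fun y => ∫ q in (0 : ℝ)..y, slowness W q with hT
    have hTc : Continuous T := intervalIntegral.continuous_primitive hint 0
    have hTs : ∀ y z, ∫ q in y..z, slowness W q = T z - T y := fun y z =>
      (intervalIntegral.integral_interval_sub_left (hint _ _) (hint _ _)).symm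
    have hc : Continuous fun e => T (h - e) - T (g + e) := by fun_prop
    have := hc.continuousAt.tendsto.mono_left (nhdsWithin_le_nhds (a := 0) (s := Ioi 0))
    simp only [sub_zero, add_zero] at this
    rw [hTs]
    refine le_of_tendsto this ?_
    filter_upwards [Ioo_mem_nhdsGT (show 0 < (h - g) / 2 by linarith)] with e he
    rw [← hTs]
    exact H _ _ (by linarith [he.1]) (by linarith [he.2]) (by linarith [he.1])
  have hsl : ∀ q, 0 ≤ slowness W q := fun q => inv_nonneg.2 (Real.sqrt_nonneg _)
  have ca := hat a ⟨le_rfl, hab⟩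
  have cb := hat b ⟨hab, le_rfl⟩
  rcases lt_trichotomy (φ (a, 1)).1 (φ (b, 1)).1 with h | h | h
  · rw [abs_of_nonneg (intervalIntegral.integral_nonneg h.le fun q _ => hsl q)]
    refine lim _ _ h fun u v hu huv hv => key u v huv ?_
    filter_upwards [ca.eventually (gt_mem_nhds hu), cb.eventually (lt_mem_nhds hv)] with p h1 h2
    exact (Icc_subset_Icc h1.le h2.le).trans Icc_subset_uIcc
  · rw [h, intervalIntegral.integral_same, abs_zero]; linarith
  · rw [intervalIntegral.integral_symm, abs_neg,
      abs_of_nonneg (intervalIntegral.integral_nonneg h.le fun q _ => hsl q)]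
    refine lim _ _ h fun u v hu huv hv => key u v huv ?_
    filter_upwards [cb.eventually (gt_mem_nhds hu), ca.eventually (lt_mem_nhds hv)] with p h1 h2
    exact (Icc_subset_Icc h1.le h2.le).trans Icc_subset_uIcc'

/-- Where `W` vanishes on `[0, η]`, an energy- and area-conserving map sends the ends of
`[0, η] × {1}` to points whose travel time from each other is at most `η`. -/
theorem abs_integral_slowness_le {W : ℝ → ℝ} (hWc : Continuous W) (hW : ∀ q, W q < 1 / 2)
    {φ : ℝ × ℝ → ℝ × ℝ} {U : Set (ℝ × ℝ)} (hUo : IsOpen U) (hφ : ContinuousOn φ U)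
    (harea : AreaConservingOn φ U) (hen : ∀ z ∈ U, mechH W (φ z) = mechH W z)
    {η : ℝ} (hη : 0 ≤ η) (hU : ∀ q ∈ Icc 0 η, (q, (1 : ℝ)) ∈ U) (hW0 : ∀ q ∈ Icc 0 η, W q = 0)
    (hpos : 0 < (φ (0, 1)).2) :
    |∫ q in (φ (0, 1)).1..(φ (η, 1)).1, slowness W q| ≤ η := by
  have hline : ContinuousOn (fun q : ℝ => φ (q, 1)) (Icc 0 η) :=
    hφ.comp (f := fun q : ℝ => (q, (1 : ℝ))) (by fun_prop) fun q hq => hU q hq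
  have hpos' : ∀ x ∈ Icc 0 η, 0 < (φ (x, 1)).2 := by
    intro x hx
    by_contra hneg
    obtain ⟨y, hy, hy0⟩ := isPreconnected_Icc.intermediate_value hx ⟨le_rfl, hη⟩
      (continuous_snd.comp_continuousOn hline) ⟨not_lt.1 hneg, hpos.le⟩
    have h1 := hen _ (hU y hy)
    simp only [Function.comp] at hy0
    simp only [mechH, hy0, hW0 y hy] at h1
    linarith [hW (φ (y, 1)).1]
  have hint : ∀ y z, IntervalIntegrable (slowness W) volume y z :=
    fun y z => (continuous_slowness hWc hW).intervalIntegrable y z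
  have hTc : Continuous fun y => ∫ q in (φ (0, 1)).1..y, slowness W q :=
    intervalIntegral.continuous_primitive hint _
  have hc : ContinuousOn (fun y => y - |∫ q in (φ (0, 1)).1..(φ (y, 1)).1, slowness W q|)
      (Icc 0 η) :=
    continuousOn_id.sub ((hTc.comp_continuousOn (continuous_fst.comp_continuousOn hline)).abs)
  have hcl : IsClosed ({y | |∫ q in (φ (0, 1)).1..(φ (y, 1)).1, slowness W q| ≤ y} ∩ Icc 0 η) := by
    have := hc.preimage_isClosed_of_isClosed isClosed_Icc (isClosed_Ici (a := 0))
    rw [inter_comm]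
    convert this using 2
    ext y
    simp
  -- Continuous induction on the right endpoint glues the local bounds.
  refine hcl.Icc_subset_of_forall_mem_nhdsWithin (by simp) ?_ ⟨hη, le_rfl⟩
  rintro x ⟨hx, hx0, hxη⟩
  obtain ⟨δ, hδ, H⟩ := exists_integral_slowness_le hWc hW hUo hφ harea hen (hU x ⟨hx0, hxη.le⟩)
    (hpos' x ⟨hx0, hxη.le⟩)
  filter_upwards [Ioo_mem_nhdsGT (show x < min (x + δ) η from lt_min (by linarith) hxη)] with y hy
  have hy2 := lt_min_iff.1 hy.2
  have h1 := H x y (by linarith) hy.1.le hy2.1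
    fun q hq => hW0 q ⟨hx0.trans hq.1, hq.2.trans hy2.2.le⟩
  show |_| ≤ y
  rw [← intervalIntegral.integral_add_adjacent_intervals (hint _ (φ (x, 1)).1) (hint _ _)]
  have h2 := abs_add_le (∫ q in (φ (0, 1)).1..(φ (x, 1)).1, slowness W q)
    (∫ q in (φ (x, 1)).1..(φ (y, 1)).1, slowness W q)
  have h3 : |∫ q in (φ (0, 1)).1..(φ (x, 1)).1, slowness W q| ≤ x := hx
  linarith


/-! ### Rigidity for the free Hamiltonian -/

theorem freeH_eq_mechH : freeH = mechH fun _ => 0 := by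
  funext z; simp [freeH, mechH]

theorem integral_slowness_zero (a b : ℝ) : ∫ q in a..b, slowness (fun _ => 0) q = b - a := by
  simp [slowness]

/-- A continuous map that conserves `p²/2` and area does not shrink segments of the line `p = 1` on
which it does not increase distances. -/
theorem exists_abs_sub_eq {φ : ℝ × ℝ → ℝ × ℝ} {U : Set (ℝ × ℝ)} (hUo : IsOpen U)
    (hφ : ContinuousOn φ U) (harea : AreaConservingOn φ U)
    (hen : ∀ z ∈ U, freeH (φ z) = freeH z) (hU : ((0 : ℝ), (1 : ℝ)) ∈ U)
    (hpos : 0 < (φ (0, 1)).2) :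
    ∃ δ > 0, ∀ η, 0 ≤ η → η < δ → |(φ (η, 1)).1 - (φ (0, 1)).1| = η := by
  obtain ⟨δ₁, hδ₁, hlip⟩ := exists_integral_slowness_le (W := fun _ => 0) continuous_const
    (by norm_num) hUo hφ harea (by rw [← freeH_eq_mechH]; exact hen) hU hpos
  simp only [integral_slowness_zero] at hlip
  obtain ⟨N, hN, hNarea⟩ := harea _ hU
  have hcx : ContinuousAt φ (0, 1) := hφ.continuousAt (hUo.mem_nhds hU)
  have hpn : ∀ᶠ z in 𝓝 ((0 : ℝ), (1 : ℝ)), 0 < (φ z).2 :=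
    (continuous_snd.continuousAt.comp hcx).eventually (lt_mem_nhds hpos)
  obtain ⟨δ₂, hδ₂, hball⟩ := Metric.mem_nhds_iff.1 (inter_mem (inter_mem hN (hUo.mem_nhds hU)) hpn)
  have hbox : ∀ q p, -δ₂ < q → q < δ₂ → 1 - δ₂ < p → p < 1 + δ₂ →
      (q, p) ∈ (N ∩ U) ∩ {z | 0 < (φ z).2} := by
    intro q p h1 h2 h3 h4
    refine hball ?_
    rw [Metric.mem_ball, Prod.dist_eq, max_lt_iff, Real.dist_eq, Real.dist_eq, abs_lt, abs_lt]
    refine ⟨⟨?_, ?_⟩, ?_, ?_⟩ <;> simp only <;> linarith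
  refine ⟨min δ₁ δ₂, lt_min hδ₁ hδ₂, fun η hη hηδ => ?_⟩
  obtain ⟨hη₁, hη₂⟩ := lt_min_iff.1 hηδ
  have hat : ∀ q ∈ Icc 0 η, ContinuousAt φ (q, 1) := fun q hq =>
    hφ.continuousAt (hUo.mem_nhds (hbox q 1 (by linarith [hq.1]) (by linarith [hq.2])
      (by linarith) (by linarith)).1.2)
  set f : ℝ → ℝ := fun q => (φ (q, 1)).1 with hf
  have hfc : ContinuousOn f (Icc 0 η) := fun q hq =>
    (continuous_fst.continuousAt.comp (ContinuousAt.comp (f := fun q : ℝ => (q, (1 : ℝ)))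
      (hat q hq) (by fun_prop))).continuousWithinAt
  have hne : (Icc 0 η).Nonempty := ⟨0, le_rfl, hη⟩
  obtain ⟨x, hx, hxmax⟩ := isCompact_Icc.exists_isMaxOn hne hfc
  obtain ⟨y, hy, hymin⟩ := isCompact_Icc.exists_isMinOn hne hfc
  -- Heights are preserved, so a thin rectangle's image fits in one of width `f x - f y + ε`; equal
  -- areas force this width to be at least `η`.
  have hosc : η ≤ f x - f y := by
    refine le_of_forall_pos_le_add fun ε hε => ?_
    have hev : ∀ᶠ p in 𝓝 (1 : ℝ), ∀ q ∈ Icc 0 η,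
        (φ (q, p)).1 ∈ Ioo (f y - ε / 2) (f x + ε / 2) := by
      refine isCompact_Icc.eventually_forall_of_forall_eventually
        (P := fun p q => (φ (q, p)).1 ∈ Ioo (f y - ε / 2) (f x + ε / 2)) fun q hq => ?_
      have h1 : ContinuousAt (fun z : ℝ × ℝ => (φ (z.2, z.1)).1) (1, q) :=
        continuous_fst.continuousAt.comp (ContinuousAt.comp (f := fun z : ℝ × ℝ => (z.2, z.1))
          (hat q hq) (by fun_prop))
      refine h1.eventually (Ioo_mem_nhds ?_ ?_)
      · have := hymin hq
        simp only [mem_ofPred_eq, hf] at this ⊢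
        linarith
      · have := hxmax hq
        simp only [mem_ofPred_eq, hf] at this ⊢
        linarith
    obtain ⟨r, hr, hrb⟩ := Metric.eventually_nhds_iff.1 hev
    set s := min r δ₂ with hs
    have hs0 : 0 < s := lt_min hr hδ₂
    have hsr : s ≤ r := min_le_left _ _
    have hsd : s ≤ δ₂ := min_le_right _ _
    have hmem : ∀ z ∈ Icc 0 η ×ˢ Ioo 1 (1 + s), z ∈ (N ∩ U) ∩ {z | 0 < (φ z).2} := by
      rintro ⟨q, p⟩ ⟨hq, hp⟩
      exact hbox q p (by linarith [hq.1]) (by linarith [hq.2]) (by linarith [hp.1])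
        (by linarith [hp.2])
    have hsub : φ '' (Icc 0 η ×ˢ Ioo 1 (1 + s)) ⊆
        Ioo (f y - ε / 2) (f x + ε / 2) ×ˢ Ioo 1 (1 + s) := by
      rintro _ ⟨⟨q, p⟩, hz, rfl⟩
      obtain ⟨⟨-, hzU⟩, hzp⟩ := hmem _ hz
      have hz1 : q ∈ Icc 0 η := hz.1
      have hz2 : p ∈ Ioo 1 (1 + s) := hz.2
      refine ⟨hrb (y := p) ?_ q hz1, ?_⟩
      · rw [Real.dist_eq, abs_lt]
        constructor <;> linarith [hz2.1, hz2.2]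
      · have h := hen _ hzU
        simp only [freeH, mem_ofPred_eq] at h hzp
        have : (φ (q, p)).2 = p := by nlinarith [hz2.1]
        rw [this]; exact hz2
    have h := measure_mono (μ := volume) hsub
    have hnn : f y ≤ f x := hymin hx
    rw [hNarea _ (fun z hz => (hmem z hz).1) (measurableSet_Icc.prod measurableSet_Ioo),
      Measure.volume_eq_prod, Measure.prod_prod, Measure.prod_prod, Real.volume_Icc,
      Real.volume_Ioo, Real.volume_Ioo, ← ENNReal.ofReal_mul (by linarith),
      ← ENNReal.ofReal_mul (by linarith),
      ENNReal.ofReal_le_ofReal_iff (mul_nonneg (by linarith) (by linarith))] at h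
    nlinarith
  have hl : ∀ a ∈ Icc 0 η, ∀ b ∈ Icc 0 η, a ≤ b → |f b - f a| ≤ b - a := fun a ha b hb hab =>
    hlip a b (by linarith [ha.1]) hab (by linarith [hb.2]) fun _ _ => trivial
  show |f η - f 0| = η
  have h0η := hl 0 ⟨le_rfl, hη⟩ η ⟨hη, le_rfl⟩ hη
  -- As `f` is 1-Lipschitz, an oscillation of at least `η` puts the extrema at the two ends.
  rcases le_total x y with hxy | hxy
  · have h1 := hl x hx y hy hxy
    rw [abs_le] at h1
    have hx0 : x = 0 := by linarith [hx.1, hy.2]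
    have hyη : y = η := by linarith [hx.1, hy.2]
    subst hx0
    rw [hyη] at hosc
    refine le_antisymm (by linarith) ?_
    rw [abs_sub_comm]
    exact hosc.trans (le_abs_self _)
  · have h1 := hl y hy x hx hxy
    rw [abs_le] at h1
    have hy0 : y = 0 := by linarith [hy.1, hx.2]
    have hxη : x = η := by linarith [hy.1, hx.2]
    subst hy0
    rw [hxη] at hosc
    exact le_antisymm (by linarith) (hosc.trans (le_abs_self _))

/-! ### Perturbation by a bump, and consistency -/

theorem sub_lt_integral_slowness {W : ℝ → ℝ} (hWc : Continuous W) (hW : ∀ q, W q < 1 / 2)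
    (hW0 : ∀ q, 0 ≤ W q) {a b x : ℝ} (hx : x ∈ Ioo a b) (hWx : 0 < W x) :
    b - a < ∫ q in a..b, slowness W q := by
  have h : ∫ _ in a..b, (1 : ℝ) < ∫ q in a..b, slowness W q := by
    refine intervalIntegral.integral_lt_integral_of_continuousOn_of_le_of_exists_lt
      (hx.1.trans hx.2) continuousOn_const (continuous_slowness hWc hW).continuousOn ?_
      ⟨x, Ioo_subset_Icc_self hx, ?_⟩
    · intro q _
      exact (one_le_inv₀ (sqrt_speed_pos hW q)).2 (Real.sqrt_le_one.2 (by linarith [hW0 q]))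
    · exact (one_lt_inv₀ (sqrt_speed_pos hW x)).2
        ((Real.sqrt_lt' one_pos).2 (by linarith))
  simpa using h

theorem contDiff_freeH : ContDiff ℝ ∞ freeH := by unfold freeH; fun_prop

theorem contDiff_mechH {W : ℝ → ℝ} (hW : ContDiff ℝ ∞ W) : ContDiff ℝ ∞ (mechH W) := by
  unfold mechH; fun_prop

/-- Only the position of a sample point matters, so a bump has to avoid just finitely many reals. -/
theorem partialD_mechH_eq {W : ℝ → ℝ} {z : ℝ × ℝ} (h : ∀ᶠ q in 𝓝 z.1, W q = 0) (α : ℕ × ℕ) :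
    partialD α (mechH W) z = partialD α freeH z := by
  refine Filter.EventuallyEq.iteratedDeriv_eq _ ?_
  filter_upwards [h] with q hq
  simp [mechH, freeH, hq]

theorem hamVF_freeH (q p : ℝ) : hamVF freeH (q, p) = (p, 0) := by
  simp [hamVF, partialD, freeH]

/-- Small steps of a consistent integrator move `(0, 1)` to the right and keep `p` positive. -/
theorem ConsistentAt.eventually_pos {Φ : Integrator} (h : ConsistentAt Φ freeH (0, 1)) :
    ∀ᶠ Δt in 𝓝[>] (0 : ℝ≥0), ∃ w, Φ freeH (0, 1) Δt = some w ∧ 0 < w.1 ∧ 0 < w.2 := by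
  obtain ⟨γ, φ, h0, hγ, hdef, hlim⟩ := h
  have hd : HasDerivAt γ (1, 0) 0 := by
    have := hγ.self_of_nhds
    simpa only [h0, hamVF_freeH] using this
  have hcoe : Tendsto ((↑) : ℝ≥0 → ℝ) (𝓝[>] 0) (𝓝[>] 0) := by
    refine tendsto_nhdsWithin_iff.2 ⟨?_, ?_⟩
    · exact (NNReal.continuous_coe.tendsto' 0 0 rfl).mono_left nhdsWithin_le_nhds
    · filter_upwards [self_mem_nhdsWithin] with t ht
      exact NNReal.coe_pos.2 ht
  -- The exact flow has speed 1, and the step error will be below `t / 2`.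
  have hd1 : ∀ᶠ t in 𝓝[>] (0 : ℝ), t / 2 < (γ t).1 := by
    have h1 := (hasDerivAt_iff_tendsto_slope.1 hd.fst).mono_left
      (nhdsWithin_mono 0 fun x (hx : 0 < x) => hx.ne')
    filter_upwards [h1.eventually (lt_mem_nhds (by norm_num : (1 / 2 : ℝ) < 1)),
      self_mem_nhdsWithin] with t ht (ht0 : 0 < t)
    rw [slope_def_field, h0, sub_zero, sub_zero, lt_div_iff₀ ht0] at ht
    linarith
  have hd2 : ∀ᶠ t in 𝓝[>] (0 : ℝ), t < 1 / 2 ∧ 1 / 2 < (γ t).2 := by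
    have h1 : ContinuousAt (fun t => (γ t).2) 0 := continuous_snd.continuousAt.comp hd.continuousAt
    refine nhdsWithin_le_nhds ?_
    filter_upwards [gt_mem_nhds (by norm_num : (0 : ℝ) < 1 / 2),
      h1.eventually (lt_mem_nhds (by rw [h0]; norm_num : (1 / 2 : ℝ) < (γ 0).2))] with t h2 h3
    exact ⟨h2, h3⟩
  filter_upwards [hdef, hlim.eventually (gt_mem_nhds (by norm_num : (0 : ℝ) < 1 / 2)),
    hcoe.eventually hd1, hcoe.eventually hd2, self_mem_nhdsWithin] with t h1 h2 h3 h4 ht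
  have ht0 : (0 : ℝ) < t := NNReal.coe_pos.2 ht
  rw [div_lt_iff₀ ht0] at h2
  have h5 := (norm_fst_le (γ t - φ t)).trans_lt h2
  have h6 := (norm_snd_le (γ t - φ t)).trans_lt h2
  rw [Prod.fst_sub, Real.norm_eq_abs, abs_lt] at h5
  rw [Prod.snd_sub, Real.norm_eq_abs, abs_lt] at h6
  exact ⟨φ t, h1, by linarith [h5.2], by linarith [h6.2, h4.2]⟩

/-- In each nonempty open interval there is a bump function avoiding a given finite set. -/
theorem exists_bump {a b : ℝ} (hab : a < b) {F : Set ℝ} (hF : F.Finite) :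
    ∃ (V : ℝ → ℝ) (x : ℝ), ContDiff ℝ ∞ V ∧ HasCompactSupport V ∧ (∀ q, 0 ≤ V q ∧ V q < 1 / 2) ∧
      x ∈ Ioo a b ∧ 0 < V x ∧ (∀ q ∉ Ioo a b, V q = 0) ∧
      ∀ q ∈ F, ∀ᶠ y in 𝓝 q, V y = 0 := by
  obtain ⟨x, hx, hxF⟩ := (Ioo_infinite hab).exists_notMem_finite hF
  have hO : Ioo a b \ F ∈ 𝓝 x := (isOpen_Ioo.sdiff hF.isClosed).mem_nhds ⟨hx, hxF⟩
  obtain ⟨f, hfs, hfc, hfd, hfr, hfx⟩ := exists_contDiff_tsupport_subset (n := ⊤) hO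
  have hf : ∀ q, 0 ≤ f q ∧ f q ≤ 1 := fun q => hfr (mem_range_self q)
  refine ⟨fun q => 1 / 4 * f q, x, contDiff_const.mul hfd, hfc.mul_left, fun q => ?_, hx, ?_, ?_, ?_⟩
  · constructor <;> linarith [(hf q).1, (hf q).2]
  · simp only [hfx]; norm_num
  · intro q hq
    have : q ∉ tsupport f := fun h => hq (hfs h).1
    simp [image_eq_zero_of_notMem_tsupport this]
  · intro q hq
    have : q ∉ tsupport f := fun h => (hfs h).2 hq
    filter_upwards [notMem_tsupport_iff_eventuallyEq.1 this] with y hy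
    simp [hy]

/-- If a map with the energy and area properties for `p²/2 + W(q)` sends `(0, 1)` and `(η, 1)` to
points at distance `η`, then `W`, vanishing on `[0, η]`, is nowhere positive between these points. -/
theorem not_definedContAreaOn_mechH {Φ : Integrator} (hen : EnergyConserving Φ)
    {U : Set (ℝ × ℝ)} (hUo : IsOpen U) (hU : ∀ q : ℝ, (q, (1 : ℝ)) ∈ U) {W : ℝ → ℝ}
    (hWs : ContDiff ℝ ∞ W) (hW : ∀ q, 0 ≤ W q ∧ W q < 1 / 2) {η x : ℝ} (hη : 0 ≤ η)
    (hW0 : ∀ q ∈ Icc 0 η, W q = 0) {Δt : ℝ≥0} {w w' : ℝ × ℝ}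
    (hw : Φ (mechH W) (0, 1) Δt = some w) (hw' : Φ (mechH W) (η, 1) Δt = some w')
    (hpos : 0 < w.2) (hdist : |w'.1 - w.1| = η)
    (hx : x ∈ Ioo (min w.1 w'.1) (max w.1 w'.1)) (hWx : 0 < W x) :
    ¬ DefinedContAreaOn (fun z => Φ (mechH W) z Δt) U := by
  rintro ⟨φ, hdef, hφ, harea⟩
  have e0 : φ (0, 1) = w := Option.some.inj ((hdef _ (hU 0)).symm.trans hw)
  have e1 : φ (η, 1) = w' := Option.some.inj ((hdef _ (hU η)).symm.trans hw')
  have h := abs_integral_slowness_le hWs.continuous (fun q => (hW q).2) hUo hφ harea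
    (fun z hz => hen _ (contDiff_mechH hWs) z Δt _ (hdef z hz)) hη (fun q _ => hU q) hW0
    (by rw [e0]; exact hpos)
  rw [e0, e1] at h
  have key := sub_lt_integral_slowness hWs.continuous (fun q => (hW q).2) (fun q => (hW q).1)
    hx hWx
  rcases le_total w.1 w'.1 with hle | hle
  · rw [min_eq_left hle, max_eq_right hle] at key
    rw [abs_of_nonneg (by linarith)] at hdist
    linarith [(abs_le.1 h).2]
  · rw [min_eq_right hle, max_eq_left hle, intervalIntegral.integral_symm] at key
    rw [abs_of_nonpos (by linarith)] at hdist
    linarith [(abs_le.1 h).1]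

end OneDOF

theorem theorem1
    (Φ : OneDOF.Integrator) (U : Set (ℝ × ℝ)) (hUo : IsOpen U) (hU : ∀ q : ℝ, (q, (1 : ℝ)) ∈ U)
    (hcons : OneDOF.ConsistentAt Φ OneDOF.freeH (0, 1))
    (hreas : OneDOF.ComputationallyReasonable Φ)
    (hen : OneDOF.EnergyConserving Φ)
    (hgood : ∃ Δt₀ : ℝ≥0, 0 < Δt₀ ∧ ∀ Δt : ℝ≥0, 0 < Δt → Δt ≤ Δt₀ →
      OneDOF.DefinedContAreaOn (fun z => Φ OneDOF.freeH z Δt) U) :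
    ∃ Δt₁ : ℝ≥0, 0 < Δt₁ ∧ ∀ Δt : ℝ≥0, 0 < Δt → Δt ≤ Δt₁ →
      ∃ V : ℝ → ℝ, ContDiff ℝ ∞ V ∧ HasCompactSupport V ∧ (∀ q, 0 ≤ V q ∧ V q < 1 / 2) ∧
        ¬ OneDOF.DefinedContAreaOn (fun z => Φ (OneDOF.mechH V) z Δt) U ∧
        ∀ c : ℝ, 0 < c → c < 1 →
          ¬ OneDOF.DefinedContAreaOn
            (fun z => Φ (OneDOF.mechH (fun q => c * V q)) z Δt) U := by
  open OneDOF in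
  obtain ⟨Δt₀, hΔt₀, hgood⟩ := hgood
  obtain ⟨τ, hτ, hτΦ⟩ := mem_nhdsGT_iff_exists_Ioc_subset.1 hcons.eventually_pos
  refine ⟨min Δt₀ τ, lt_min hΔt₀ hτ, fun Δt hΔt hle => ?_⟩
  obtain ⟨w, hw, hw1, hw2⟩ := hτΦ ⟨hΔt, hle.trans (min_le_right _ _)⟩
  obtain ⟨φ, hdef, hφ, harea⟩ := hgood Δt hΔt (hle.trans (min_le_left _ _))
  have e0 : φ (0, 1) = w := Option.some.inj ((hdef _ (hU 0)).symm.trans hw)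
  obtain ⟨δ, hδ, hiso⟩ := exists_abs_sub_eq hUo hφ harea
    (fun z hz => hen _ contDiff_freeH z Δt _ (hdef z hz)) (hU 0) (by rw [e0]; exact hw2)
  -- `η < w.1` makes the gap between the images reach beyond `[0, η]`, where the bump must vanish.
  obtain ⟨η, hη0, hη⟩ := exists_between (lt_min hδ hw1)
  obtain ⟨hηδ, hηw⟩ := lt_min_iff.1 hη
  have hdist := hiso η hη0.le hηδ
  rw [e0] at hdist
  set w' := φ (η, 1) with hw'
  obtain ⟨a, b, hab, hsub, hdisj⟩ : ∃ a b, a < b ∧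
      Ioo a b ⊆ Ioo (min w.1 w'.1) (max w.1 w'.1) ∧ ∀ q ∈ Icc 0 η, q ∉ Ioo a b := by
    refine ⟨max η (min w.1 w'.1), max w.1 w'.1, max_lt (hηw.trans_le (le_max_left _ _)) ?_,
      Ioo_subset_Ioo_left (le_max_right _ _), fun q hq hq' => ?_⟩
    · refine min_lt_max.2 fun h => ?_
      rw [← h, sub_self, abs_zero] at hdist
      exact hη0.ne hdist
    · exact absurd (le_max_left η (min w.1 w'.1)) (by linarith [hq.2, hq'.1])
  obtain ⟨m₀, r₀, α₀, h₀⟩ := hreas _ contDiff_freeH (0, 1) Δt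
  obtain ⟨m₁, r₁, α₁, h₁⟩ := hreas _ contDiff_freeH (η, 1) Δt
  obtain ⟨V, x, hVs, hVc, hV, hx, hVx, hVab, hVr⟩ := exists_bump hab
    ((finite_range fun j => (r₀ j).1).union (finite_range fun j => (r₁ j).1))
  -- Sample points come from the free Hamiltonian, hence do not depend on `c`: one `V` serves all
  -- scalings.
  have main : ∀ c : ℝ, 0 < c → c ≤ 1 →
      ¬ DefinedContAreaOn (fun z => Φ (mechH fun q => c * V q) z Δt) U := by
    intro c hc0 hc1
    have hWs : ContDiff ℝ ∞ fun q => c * V q := contDiff_const.mul hVs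
    have hWr : ∀ z : ℝ × ℝ, z.1 ∈ (range fun j => (r₀ j).1) ∪ (range fun j => (r₁ j).1) →
        ∀ α, partialD α (mechH fun q => c * V q) z = partialD α freeH z := fun z hz α =>
      partialD_mechH_eq ((hVr _ hz).mono fun q hq => by simp [hq]) α
    refine not_definedContAreaOn_mechH hen hUo hU hWs (fun q => ⟨mul_nonneg hc0.le (hV q).1, ?_⟩)
      hη0.le (fun q hq => by simp [hVab q (hdisj q hq)]) (w := w) (w' := w') ?_ ?_ hw2 hdist
      (hsub hx) (mul_pos hc0 hVx)
    · nlinarith [(hV q).1, (hV q).2]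
    · rw [← h₀ _ (contDiff_mechH hWs) fun j => hWr _ (Or.inl ⟨j, rfl⟩) _]
      exact hw
    · rw [← h₁ _ (contDiff_mechH hWs) fun j => hWr _ (Or.inr ⟨j, rfl⟩) _]
      exact hdef _ (hU η)
  refine ⟨V, hVs, hVc, hV, ?_, fun c hc0 hc1 => main c hc0 hc1.le⟩
  simpa using main 1 one_pos le_rfl
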